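/- Let $K$ be an algebraically closed field of characteristic $0$, let $\mathfrak{s}$ be a finite-dimensional simple Lie algebra over $K$, and let $\mathfrak{t}\subset\mathfrak{s}$ be a Cartan subalgebra with root system $\Phi\subset\mathfrak{t}^*$. Assume that $\mathfrak{s}$ is simply laced, i.e. $\langle\alpha,\beta^\vee\rangle\in\{-1,0,1\}$ for all roots $\alpha\neq\pm\beta$. Let $\Lambda=\mathbb{Z}\Phi\subset\mathfrak{t}^*$ be the root lattice, with the symmetric positive-definite bilinear form $(\cdot,\cdot):\Lambda\times\Lambda\to\mathbb{Z}$ determined by $(\alpha,\beta)=\langle\beta,\alpha^\vee\rangle$ for all $\alpha,\beta\in\Phi$ (so $(\alpha,\alpha)=2$ for every root $\alpha$), and let $\mathrm{Aut}(\Lambda)$ be the group of $\mathbb{Z}$-linear bijections of $\Lambda$ preserving $(\cdot,\cdot)$. Let $w\in\mathrm{Aut}(\Lambda)$ be elliptic, i.e. such that the group of coinvariants $\Lambda/(1-w)\Lambda$ is finite. Then $w$ lifts to an automorphism of $\mathfrak{s}$ of the same order as $w$: there is a Lie algebra automorphism $\sigma$ of $\mathfrak{s}$ with $\sigma(\mathfrak{t})=\mathfrak{t}$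 and $(w\mu)(\sigma(x))=\mu(x)$ for all $\mu\in\Lambda$ and $x\in\mathfrak{t}$, such that the order of $\sigma$ equals the order of $w$. -/

import Mathlib

open Module

noncomputable section

namespace RootPairing

variable {ι K M N : Type*} [Field K] [CharZero K] [AddCommGroup M] [Module K M]
  [AddCommGroup N] [Module K N] (P : RootPairing ι K M N) [P.IsCrystallographic]

/-- A crystallographic root system is simply laced if `⟨α, β^∨⟩ ∈ {-1, 0, 1}` for all roots
`α ≠ ±β` (equivalently: its Dynkin diagram has no multiple edges). -/
def IsSimplyLaced : Prop :=
  ∀ i j : ι, P.root i ≠ P.root j → P.root i ≠ -P.root j →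
    P.pairingIn ℤ i j = -1 ∨ P.pairingIn ℤ i j = 0 ∨ P.pairingIn ℤ i j = 1

variable {P}

theorem IsSimplyLaced.pairingIn_comm [Finite ι] (h : P.IsSimplyLaced) (i j : ι) :
    P.pairingIn ℤ i j = P.pairingIn ℤ j i := by
  by_cases h1 : P.root i = P.root j
  · rw [P.root.injective h1]
  by_cases h2 : P.root i = -P.root j
  · have e : ∀ a b : ι, P.root a = -P.root b → P.pairing a b = -2 := by
      intro a b hab
      rw [← P.root_coroot'_eq_pairing, hab, map_neg, P.root_coroot'_eq_pairing, P.pairing_same]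
    have h3 : P.root j = -P.root i := by rw [h2, neg_neg]
    apply (algebraMap ℤ K).injective_int
    rw [P.algebraMap_pairingIn, P.algebraMap_pairingIn, e i j h2, e j i h3]
  · have h3 : P.root j ≠ -P.root i := fun h ↦ h2 (by rw [h, neg_neg])
    have hz := P.pairingIn_eq_zero_iff (S := ℤ) (i := i) (j := j)
    have hp := P.zero_lt_pairingIn_iff' (S := ℤ) (i := i) (j := j)
    rcases h i j h1 h2 with a | a | a <;> rcases h j i (Ne.symm h1) h3 with b | b | b <;>
      simp_all

variable (P)

/-- The map `ℤ^Φ → Λ` onto the root lattice `Λ = ℤΦ`, sending the basis vector of a root to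
that root. -/
def rootLatticeProj : (ι →₀ ℤ) →ₗ[ℤ] P.rootSpan ℤ :=
  Finsupp.linearCombination ℤ (P.rootSpanMem ℤ)

theorem rootLatticeProj_surjective : Function.Surjective P.rootLatticeProj := by
  rintro ⟨x, hx⟩
  obtain ⟨c, hc⟩ := (Finsupp.mem_span_range_iff_exists_finsupp).1 hx
  refine ⟨c, Subtype.ext ?_⟩
  change ((P.rootLatticeProj c : P.rootSpan ℤ) : M) = x
  rw [← hc, rootLatticeProj, Finsupp.linearCombination_apply, Finsupp.sum, Finsupp.sum]
  simp

/-- The map `ℤ^Φ → Hom(Λ, ℤ)` sending the basis vector of a root `α` to its coroot `α^∨`. -/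
def corootComb : (ι →₀ ℤ) →ₗ[ℤ] Dual ℤ (P.rootSpan ℤ) :=
  Finsupp.linearCombination ℤ (P.coroot'In ℤ)

variable {P}

theorem IsSimplyLaced.corootComb_apply_comm [Finite ι] (h : P.IsSimplyLaced) (c e : ι →₀ ℤ) :
    P.corootComb c (P.rootLatticeProj e) = P.corootComb e (P.rootLatticeProj c) := by
  suffices H : P.corootComb.compl₂ P.rootLatticeProj =
      (P.corootComb.compl₂ P.rootLatticeProj).flip from
    LinearMap.congr_fun₂ H c e
  ext i j
  simp [corootComb, rootLatticeProj, coroot'In_rootSpanMem_eq_pairingIn, h.pairingIn_comm i j]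

theorem IsSimplyLaced.ker_le [Finite ι] (h : P.IsSimplyLaced) :
    LinearMap.ker P.rootLatticeProj ≤ LinearMap.ker P.corootComb := by
  intro c hc
  rw [LinearMap.mem_ker] at hc ⊢
  ext x
  obtain ⟨e, rfl⟩ := P.rootLatticeProj_surjective x
  rw [h.corootComb_apply_comm, hc, map_zero, LinearMap.zero_apply]

/-- The bilinear form `(·, ·) : Λ × Λ → ℤ` on the root lattice `Λ = ℤΦ` of a simply laced root
system, normalized by `(α, α) = 2` for all roots `α`: it is the bilinear form with
`(α, β) = ⟨β, α^∨⟩` for all roots `α`, `β`. -/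
def rootLatticeForm [Finite ι] (h : P.IsSimplyLaced) : LinearMap.BilinForm ℤ (P.rootSpan ℤ) :=
  ((LinearMap.ker P.rootLatticeProj).liftQ P.corootComb h.ker_le) ∘ₗ
    (P.rootLatticeProj.quotKerEquivOfSurjective P.rootLatticeProj_surjective).symm.toLinearMap

theorem rootLatticeForm_root_root [Finite ι] (h : P.IsSimplyLaced) (i j : ι) :
    rootLatticeForm h (P.rootSpanMem ℤ i) (P.rootSpanMem ℤ j) = P.pairingIn ℤ i j := by
  have e : (P.rootLatticeProj.quotKerEquivOfSurjective P.rootLatticeProj_surjective).symm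
      (P.rootSpanMem ℤ i) = (LinearMap.ker P.rootLatticeProj).mkQ (Finsupp.single i 1) := by
    rw [LinearEquiv.symm_apply_eq, Submodule.mkQ_apply,
      LinearMap.quotKerEquivOfSurjective_apply_mk]
    simp [rootLatticeProj]
  rw [rootLatticeForm, LinearMap.comp_apply, LinearEquiv.coe_coe, e, Submodule.mkQ_apply,
    Submodule.liftQ_apply, h.pairingIn_comm]
  simp [corootComb, coroot'In_rootSpanMem_eq_pairingIn]

theorem rootLatticeForm_root_self [Finite ι] (h : P.IsSimplyLaced) (i : ι) :
    rootLatticeForm h (P.rootSpanMem ℤ i) (P.rootSpanMem ℤ i) = 2 := by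
  rw [rootLatticeForm_root_root, pairingIn_same]

/-- The group `Aut(Λ)` of lattice automorphisms of the root lattice: `ℤ`-linear bijections that
preserve the bilinear form. -/
def rootLatticeAut [Finite ι] (h : P.IsSimplyLaced) :
    Subgroup (P.rootSpan ℤ ≃ₗ[ℤ] P.rootSpan ℤ) where
  carrier := {w | ∀ x y, rootLatticeForm h (w x) (w y) = rootLatticeForm h x y}
  mul_mem' {v w} hv hw x y := by
    rw [LinearEquiv.mul_apply, LinearEquiv.mul_apply, hv, hw]
  one_mem' _ _ := rfl
  inv_mem' {w} hw x y := by
    have := hw (w⁻¹ x) (w⁻¹ y)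
    rw [← LinearEquiv.mul_apply, ← LinearEquiv.mul_apply, mul_inv_cancel] at this
    exact this.symm

end RootPairing

/-- An automorphism `w` of a lattice `Λ` is elliptic if the group of coinvariants
`Λ_w = Λ / (1 - w)Λ` is finite. -/
def IsEllipticAut {A : Type*} [AddCommGroup A] (w : A ≃ₗ[ℤ] A) : Prop :=
  Finite (A ⧸ LinearMap.range (LinearMap.id - w.toLinearMap))

namespace LieAlgebra

open LieAlgebra.IsKilling

variable {K L : Type*} [Field K] [CharZero K] [LieRing L] [LieAlgebra K L]
  [FiniteDimensional K L] [IsKilling K L] (H : LieSubalgebra K L) [H.IsCartanSubalgebra]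
  [LieModule.IsTriangularizable K H L]

/-- The root lattice `Λ ⊆ 𝔱*` of `L` relative to the Cartan subalgebra `H = 𝔱`: the `ℤ`-span of
the roots. -/
abbrev rootLattice : Submodule ℤ (Dual K H) := (rootSystem H).rootSpan ℤ

/-- The Lie algebra automorphism `σ` lifts the automorphism `w` of the root lattice: `σ` maps the
Cartan subalgebra `H` onto itself, and the induced action `μ ↦ μ ∘ (σ|_H)⁻¹` on `H*` restricts to
`w` on the root lattice, i.e. `(w μ) (σ x) = μ x` for all `μ ∈ Λ` and `x ∈ H`
(so that `σ` maps the root space of a root `α` onto that of `w α`). -/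
def IsLiftOf (σ : L ≃ₗ⁅K⁆ L) (w : rootLattice H ≃ₗ[ℤ] rootLattice H) : Prop :=
  H.map (σ : L →ₗ⁅K⁆ L) = H ∧
    ∀ (μ : rootLattice H) (x y : H), (y : L) = σ x →
      (w μ : Dual K H) y = (μ : Dual K H) x

end LieAlgebra

end

/-! Root vectors can be chosen so that every sign in the problem is the parity of a bilinear form.
As the root lattice is even, `(x, y) = B x y + B y x` for some integral bilinear `B`. There are root
vectors with `[e x, e y] = (-1) ^ B x y • e (x + y)` whenever `(x, y) = -1`, and `[e x, e (-x)] = -t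
x`, where `t` extends the passage to coroots (`exists_chevalley_system`).

Since `B x x` is half the norm, the change of `B` under an isometry `w` is alternating, hence of the
form `C x y - C y x`. Modulo 2 this is the polarization of `C x x`, so `t x ↦ t (w x)`, `e x ↦ (-1)
^ C x x • e (w x)` defines an automorphism `σ` (`exists_lieEquiv`).

If `w ^ n = 1`, then `σ ^ n` fixes every `t x` and multiplies `e x` by the sign of the sum of `C` on
the diagonal along the orbit of `x`. By `diag_sum_orbit_modEq` this sum is determined modulo 2 by
the orbit sum `s = x + w x + ⋯ + w ^ (n - 1) x` and vanishes if `s = 0`. Ellipticity forces `s = 0`,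
so `σ ^ n = 1`. Conversely `σ ^ n = 1` gives `w ^ n = 1` because `t` is injective. -/

noncomputable section

/-! ### Signs -/

/-- The sign `(-1) ^ n` as an element of `K`. -/
def intSign (K : Type*) [Field K] (n : ℤ) : K := (-1) ^ n

section Sign

variable {K : Type*} [Field K]

@[simp] theorem intSign_zero : intSign K 0 = 1 := by simp [intSign]

theorem intSign_one : intSign K 1 = -1 := by simp [intSign]

theorem intSign_add (m n : ℤ) : intSign K (m + n) = intSign K m * intSign K n :=
  zpow_add₀ (by simp) m n

theorem intSign_neg (n : ℤ) : intSign K (-n) = intSign K n := by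
  rcases Int.even_or_odd n with h | h
  · simp [intSign, h.neg_one_zpow, h.neg.neg_one_zpow]
  · simp [intSign, h.neg_one_zpow, h.neg.neg_one_zpow]

theorem intSign_mul_self (n : ℤ) : intSign K n * intSign K n = 1 := by
  rw [← intSign_add]
  exact (Even.add_self n).neg_one_zpow

theorem intSign_ne_zero (n : ℤ) : intSign K n ≠ 0 := zpow_ne_zero n (by simp)

theorem intSign_two_mul (n : ℤ) : intSign K (2 * n) = 1 := by
  rw [two_mul, intSign_add, intSign_mul_self]

theorem intSign_of_modEq {m n : ℤ} (h : m ≡ n [ZMOD 2]) : intSign K m = intSign K n := by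
  obtain ⟨k, hk⟩ := h.dvd
  obtain rfl : n = m + 2 * k := by omega
  rw [intSign_add, intSign_two_mul, mul_one]

end Sign

/-! ### Bilinear forms on lattices -/

section Bilinear

variable {Λ : Type*} [AddCommGroup Λ] [Module.Free ℤ Λ]

/-- An even symmetric form on a lattice is the symmetrization of a bilinear form. -/
theorem exists_add_flip_eq_of_even (S : LinearMap.BilinForm ℤ Λ) (hS : ∀ x y, S x y = S y x)
    (heven : ∀ x, Even (S x x)) :
    ∃ B : LinearMap.BilinForm ℤ Λ, ∀ x y, B x y + B y x = S x y := by
  classical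
  let b := Module.Free.chooseBasis ℤ Λ
  let _ : LinearOrder (Module.Free.ChooseBasisIndex ℤ Λ) := linearOrderOfSTO WellOrderingRel
  -- Upper triangular half of the Gram matrix, with its diagonal halved; evenness makes the division
  -- exact.
  let B : LinearMap.BilinForm ℤ Λ := b.constr ℤ fun i ↦ b.constr ℤ fun j ↦
    if i < j then S (b i) (b j) else if i = j then S (b i) (b i) / 2 else 0
  have hB : B + B.flip = S := by
    refine b.ext fun i ↦ b.ext fun j ↦ ?_
    rcases lt_trichotomy i j with h | rfl | h
    · simp [B, Basis.constr_basis, h, h.not_gt, h.ne']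
    · obtain ⟨k, hk⟩ := heven (b i)
      simp [B, Basis.constr_basis, hk]
      omega
    · simp [B, Basis.constr_basis, h, h.not_gt, h.ne', hS (b i) (b j)]
  exact ⟨B, fun x y ↦ by rw [← hB]; rfl⟩

/-- An alternating form on a lattice is the antisymmetrization of a bilinear form. -/
theorem exists_sub_flip_eq_of_alternating (D : LinearMap.BilinForm ℤ Λ) (hD : ∀ x, D x x = 0) :
    ∃ C : LinearMap.BilinForm ℤ Λ, ∀ x y, C x y - C y x = D x y := by
  classical
  let b := Module.Free.chooseBasis ℤ Λ
  let _ : LinearOrder (Module.Free.ChooseBasisIndex ℤ Λ) := linearOrderOfSTO WellOrderingRel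
  have hneg : ∀ x y, D x y = -D y x := fun x y ↦ by
    have := hD (x + y)
    simp only [map_add, LinearMap.add_apply, hD] at this
    omega
  let C : LinearMap.BilinForm ℤ Λ := b.constr ℤ fun i ↦ b.constr ℤ fun j ↦
    if i < j then D (b i) (b j) else 0
  have hC : C - C.flip = D := by
    refine b.ext fun i ↦ b.ext fun j ↦ ?_
    rcases lt_trichotomy i j with h | rfl | h
    · simp [C, Basis.constr_basis, h, h.not_gt]
    · simp [C, Basis.constr_basis, hD]
    · simp [C, Basis.constr_basis, h, h.not_gt, hneg (b i) (b j)]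
  exact ⟨C, fun x y ↦ by rw [← hC]; rfl⟩

end Bilinear

/-- If `C` antisymmetrizes to the change of `B` under `w`, then modulo two the diagonal of `C`
evaluated at a partial orbit sum of `w` is the sum of its values along the orbit, up to two
boundary terms. -/
theorem diag_sum_orbit_modEq {Λ : Type*} [AddCommGroup Λ] (w : Λ ≃ₗ[ℤ] Λ)
    (B C : LinearMap.BilinForm ℤ Λ)
    (hC : ∀ x y, C x y - C y x = B (w x) (w y) - B x y) (x : Λ) (n : ℕ) :
    C (∑ i ∈ Finset.range n, (w ^ i) x) (∑ i ∈ Finset.range n, (w ^ i) x) ≡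
      ∑ i ∈ Finset.range n, C ((w ^ i) x) ((w ^ i) x) +
        (B (∑ i ∈ Finset.range n, (w ^ i) x) ((w ^ n) x) -
          B x (w (∑ i ∈ Finset.range n, (w ^ i) x))) [ZMOD 2] := by
  induction n with
  | zero => simp
  | succ n ih =>
    have hshift : ∑ i ∈ Finset.range (n + 1), (w ^ i) x =
        x + w (∑ i ∈ Finset.range n, (w ^ i) x) := by
      rw [Finset.sum_range_succ', map_sum, add_comm]
      simp [pow_succ', LinearEquiv.mul_apply]
    -- Writing the first orbit sum as `x + w s` and the second as `s + w ^ n x` makes the two terms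
    -- `B x (w ^ (n + 1) x)` cancel. What remains differs from the boundary at `n` by the change of
    -- `B` under `w`, which `hC` matches with the cross terms of `C`.
    have hB : B (∑ i ∈ Finset.range (n + 1), (w ^ i) x) ((w ^ (n + 1)) x) -
        B x (w (∑ i ∈ Finset.range (n + 1), (w ^ i) x)) =
        B (w (∑ i ∈ Finset.range n, (w ^ i) x)) (w ((w ^ n) x)) -
          B x (w (∑ i ∈ Finset.range n, (w ^ i) x)) := by
      nth_rw 1 [hshift]
      rw [Finset.sum_range_succ, pow_succ', LinearEquiv.mul_apply]
      simp only [map_add, LinearMap.add_apply]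
      ring
    rw [hB, Finset.sum_range_succ, Finset.sum_range_succ]
    have h := hC (∑ i ∈ Finset.range n, (w ^ i) x) ((w ^ n) x)
    simp only [map_add, LinearMap.add_apply] at ih h ⊢
    generalize (∑ i ∈ Finset.range n, (w ^ i) x) = s at *
    rw [Int.modEq_iff_dvd] at ih ⊢
    obtain ⟨k, hk⟩ := ih
    exact ⟨k - C ((w ^ n) x) s, by linarith⟩

/-- An elliptic automorphism of a torsion-free group satisfies `1 + w + ⋯ + w ^ (n - 1) = 0`
whenever `w ^ n = 1`. -/
theorem IsEllipticAut.sum_pow_apply_eq_zero {Λ : Type*} [AddCommGroup Λ]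
    [IsAddTorsionFree Λ] {w : Λ ≃ₗ[ℤ] Λ} (h : IsEllipticAut w) {n : ℕ} (hn : w ^ n = 1) (x : Λ) :
    ∑ i ∈ Finset.range n, (w ^ i) x = 0 := by
  have hfin : Finite (Λ ⧸ LinearMap.range (LinearMap.id - w.toLinearMap)) := h
  obtain ⟨m, hm, hmx⟩ := (isOfFinAddOrder_of_finite (Submodule.Quotient.mk
    (p := LinearMap.range (LinearMap.id - w.toLinearMap)) x)).exists_nsmul_eq_zero
  rw [← Submodule.Quotient.mk_smul, Submodule.Quotient.mk_eq_zero] at hmx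
  obtain ⟨z, hz⟩ := hmx
  -- With `m • x = z - w z`, the multiple of the orbit sum telescopes to `z - w ^ n z = 0`.
  have key : m • ∑ i ∈ Finset.range n, (w ^ i) x = 0 := by
    rw [Finset.smul_sum]
    have : ∀ i, m • (w ^ i) x = (w ^ i) z - (w ^ (i + 1)) z := fun i ↦ by
      rw [← map_nsmul, ← hz, pow_succ, LinearEquiv.mul_apply]
      simp
    simp_rw [this]
    rw [Finset.sum_range_sub' (fun i ↦ (w ^ i) z), hn]
    simp
  exact (nsmul_eq_zero_iff_right hm.ne').1 key

/-! ### Simply laced gradings -/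

/-- A Lie algebra graded by a positive definite even lattice `Λ` in the way in which a simply laced
Lie algebra is graded by its root lattice: the degree zero part is spanned by elements `t x`
acting on the degree `y` part by the scalar `(x, y)`, and the other nonzero parts are lines, one for
each vector of norm two. -/
structure SimplyLacedGrading (K L Λ : Type*) [Field K] [LieRing L] [LieAlgebra K L]
    [AddCommGroup Λ] where
  /-- the bilinear form of the lattice -/
  form : LinearMap.BilinForm ℤ Λ
  form_comm : ∀ x y, form x y = form y x
  form_even : ∀ x, Even (form x x)
  form_pos : ∀ x, x ≠ 0 → 0 < form x x
  /-- a linear functional separating positive and negative roots -/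
  ht : Λ →ₗ[ℤ] ℤ
  ht_ne_zero : ∀ x, form x x = 2 → ht x ≠ 0
  /-- the homogeneous parts -/
  part : Λ → Submodule K L
  lie_mem : ∀ {x y u v}, u ∈ part x → v ∈ part y → ⁅u, v⁆ ∈ part (x + y)
  part_eq_bot : ∀ x, x ≠ 0 → form x x ≠ 2 → part x = ⊥
  exists_smul_eq : ∀ x, form x x = 2 → ∀ u ∈ part x, u ≠ 0 → ∀ v ∈ part x, ∃ c : K, v = c • u
  /-- the coroot attached to a lattice vector -/
  t : Λ →+ L
  part_zero : part 0 = Submodule.span K (Set.range t)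
  t_lie : ∀ x {y v}, v ∈ part y → ⁅t x, v⁆ = (form x y : K) • v
  exists_lie_eq : ∀ x, form x x = 2 → ∃ u ∈ part x, u ≠ 0 ∧ ∃ v ∈ part (-x), ⁅u, v⁆ = t x
  t_comb_eq_zero_iff : ∀ a : Λ →₀ K, (a.sum fun x k ↦ k • t x) = 0 ↔
    ∀ y, (a.sum fun x k ↦ k * (form x y : K)) = 0
  iSupIndep_part : iSupIndep part
  iSup_part : ⨆ x, part x = ⊤

namespace SimplyLacedGrading

variable {K L Λ : Type*} [Field K] [LieRing L] [LieAlgebra K L] [AddCommGroup Λ]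
  (G : SimplyLacedGrading K L Λ)

theorem form_add_self (x y : Λ) :
    G.form (x + y) (x + y) = G.form x x + 2 * G.form x y + G.form y y := by
  simp only [map_add, LinearMap.add_apply, G.form_comm y x]
  ring

theorem form_neg_self (x : Λ) : G.form (-x) (-x) = G.form x x := by simp

theorem form_sub_self (x y : Λ) :
    G.form (x - y) (x - y) = G.form x x - 2 * G.form x y + G.form y y := by
  simp only [map_sub, LinearMap.sub_apply, G.form_comm y x]
  ring

theorem eq_zero_of_form_self_eq_zero {x : Λ} (h : G.form x x = 0) : x = 0 := by
  by_contra hx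
  exact (G.form_pos x hx).ne' h

theorem part_eq_bot_of_two_lt {x : Λ} (h : 2 < G.form x x) : G.part x = ⊥ :=
  G.part_eq_bot x (by rintro rfl; simp at h) h.ne'

theorem neg_one_le_form {x y : Λ} (hx : G.form x x = 2) (hy : G.form y y = 2) (h : x + y ≠ 0) :
    -1 ≤ G.form x y := by
  have := G.form_pos _ h
  rw [form_add_self, hx, hy] at this
  omega

theorem form_add_self_eq_two {x y : Λ} (hx : G.form x x = 2) (hy : G.form y y = 2)
    (h : G.form x y = -1) : G.form (x + y) (x + y) = 2 := by
  rw [form_add_self, hx, hy, h]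
  norm_num

theorem lie_eq_zero {x y : Λ} (hx : G.form x x = 2) (hy : G.form y y = 2)
    (h : 0 ≤ G.form x y) {u v : L} (hu : u ∈ G.part x) (hv : v ∈ G.part y) : ⁅u, v⁆ = 0 := by
  have := G.lie_mem hu hv
  rwa [G.part_eq_bot_of_two_lt (by rw [form_add_self]; omega), Submodule.mem_bot] at this

theorem t_mem (x : Λ) : G.t x ∈ G.part 0 := by
  rw [G.part_zero]
  exact Submodule.subset_span ⟨x, rfl⟩

theorem t_lie_t (x y : Λ) : ⁅G.t x, G.t y⁆ = 0 := by
  simpa using G.t_lie x (G.t_mem y)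

/-- Dual root vectors: a nonzero vector of degree `x` has a partner of degree `-x`. -/
theorem exists_lie_eq_t {x : Λ} (hx : G.form x x = 2) {u : L} (hu : u ∈ G.part x) (hu0 : u ≠ 0) :
    ∃ v ∈ G.part (-x), ⁅u, v⁆ = G.t x := by
  obtain ⟨u', hu', -, v, hv, h⟩ := G.exists_lie_eq x hx
  obtain ⟨c, rfl⟩ := G.exists_smul_eq x hx u hu hu0 u' hu'
  exact ⟨c • v, Submodule.smul_mem _ _ hv, by rw [← h, lie_smul, smul_lie]⟩

/-- If `[u, v] = 0`, take a partner `u'` of `u` in degree `-x`. It also kills `v`, because `y - x`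
has norm 6, so by Jacobi `t x` kills `v`; but it acts by `-1`. -/
theorem lie_ne_zero {x y : Λ} (hx : G.form x x = 2) (hy : G.form y y = 2)
    (h : G.form x y = -1) {u v : L} (hu : u ∈ G.part x) (hu0 : u ≠ 0) (hv : v ∈ G.part y)
    (hv0 : v ≠ 0) : ⁅u, v⁆ ≠ 0 := by
  intro h0
  obtain ⟨u', hu', huu'⟩ := G.exists_lie_eq_t hx hu hu0
  have h1 : ⁅u', v⁆ = 0 := by
    have := G.lie_mem hu' hv
    rwa [G.part_eq_bot_of_two_lt (by rw [form_add_self]; simp; omega), Submodule.mem_bot] at this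
  have h2 := lie_lie u u' v
  rw [h0, h1, huu', G.t_lie x hv, h] at h2
  simp [hv0] at h2

/-! ### Normalized positive root vectors -/

variable (B : LinearMap.BilinForm ℤ Λ)

/-- The pairs of positive roots with sum `z`. -/
def IsPosDecomp (z : Λ) (p : Λ × Λ) : Prop :=
  G.form p.1 p.1 = 2 ∧ G.form p.2 p.2 = 2 ∧ 0 < G.ht p.1 ∧ 0 < G.ht p.2 ∧ G.form p.1 p.2 = -1 ∧
    p.1 + p.2 = z

open Classical in
/-- Root vectors for the positive roots, normalized recursively by the signs `(-1) ^ B x y`. -/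
def posVec (z : Λ) : L :=
  if h : ∃ p, G.IsPosDecomp z p then
    intSign K (B h.choose.1 h.choose.2) • ⁅posVec h.choose.1, posVec h.choose.2⁆
  else if hz : G.form z z = 2 then (G.exists_lie_eq z hz).choose else 0
termination_by (G.ht z).toNat
decreasing_by
  all_goals
    obtain ⟨-, -, h1, h2, -, h3⟩ := h.choose_spec
    have := congrArg G.ht h3
    rw [map_add] at this
    omega

/-- The value that the decomposition `(x, y)` prescribes for the root vector of `x + y`. -/
def decompVec (x y : Λ) : L := intSign K (B x y) • ⁅G.posVec B x, G.posVec B y⁆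

/-- The root vectors constructed for the positive roots of height at most `n` are nonzero, and
compatible with all decompositions. -/
def PosVecGood (n : ℤ) : Prop :=
  ∀ z, G.form z z = 2 → 0 < G.ht z → G.ht z ≤ n →
    (G.posVec B z ∈ G.part z ∧ G.posVec B z ≠ 0) ∧
      ∀ x y, G.IsPosDecomp z (x, y) → G.decompVec B x y = G.posVec B z

variable {G B}

theorem lie_posVec_eq {z x y : Λ} (h : G.decompVec B x y = G.posVec B z) :
    ⁅G.posVec B x, G.posVec B y⁆ = intSign K (B x y) • G.posVec B z := by
  rw [← h, decompVec, smul_smul, intSign_mul_self, one_smul]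

theorem intSign_form (hB : ∀ x y, B x y + B y x = G.form x y) {x y : Λ} (h : G.form x y = -1) :
    intSign K (B y x) = -intSign K (B x y) := by
  have : B y x = -(B x y) + -1 := by rw [← h, ← hB]; ring
  rw [this, intSign_add, intSign_neg, intSign_neg, intSign_one, mul_neg_one]

theorem decompVec_comm (hB : ∀ x y, B x y + B y x = G.form x y) {x y : Λ}
    (h : G.form x y = -1) : G.decompVec B x y = G.decompVec B y x := by
  rw [decompVec, decompVec, intSign_form hB h, ← lie_skew, neg_smul, smul_neg]

/-- This is the Jacobi identity, with one term missing because `[e a, e b] = 0`. The signs agree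
since a bilinear form is a 2-cocycle: `B (a + d) b + B a d = B a (d + b) + B d b`. -/
theorem decompVec_assoc {n : ℤ} (ih : G.PosVecGood B n) {a d b : Λ} (ha : G.form a a = 2)
    (hd : G.form d d = 2) (hb : G.form b b = 2) (ha0 : 0 < G.ht a) (hd0 : 0 < G.ht d)
    (hb0 : 0 < G.ht b) (hn : G.ht a + G.ht d + G.ht b ≤ n + 1) (had : G.form a d = -1)
    (hdb : G.form d b = -1) (hab : G.form a b = 0) :
    G.decompVec B (a + d) b = G.decompVec B a (d + b) := by
  obtain ⟨⟨hma, -⟩, -⟩ := ih a ha ha0 (by omega)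
  obtain ⟨⟨hmb, -⟩, -⟩ := ih b hb hb0 (by omega)
  have e1 := lie_posVec_eq <| (ih (a + d) (G.form_add_self_eq_two ha hd had)
    (by rw [map_add]; omega) (by rw [map_add]; omega)).2 a d ⟨ha, hd, ha0, hd0, had, rfl⟩
  have e2 := lie_posVec_eq <| (ih (d + b) (G.form_add_self_eq_two hd hb hdb)
    (by rw [map_add]; omega) (by rw [map_add]; omega)).2 d b ⟨hd, hb, hd0, hb0, hdb, rfl⟩
  have e0 : ⁅G.posVec B a, G.posVec B b⁆ = 0 := G.lie_eq_zero ha hb hab.ge hma hmb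
  have hJ := lie_lie (G.posVec B a) (G.posVec B d) (G.posVec B b)
  rw [e0, lie_zero, sub_zero, e1, e2, smul_lie, lie_smul] at hJ
  simp only [decompVec, map_add, LinearMap.add_apply, intSign_add]
  have s1 := intSign_mul_self (K := K) (B a d)
  have s2 := intSign_mul_self (K := K) (B d b)
  calc (intSign K (B a b) * intSign K (B d b)) • ⁅G.posVec B (a + d), G.posVec B b⁆
      = (intSign K (B a b) * intSign K (B d b) * intSign K (B a d)) •
        intSign K (B a d) • ⁅G.posVec B (a + d), G.posVec B b⁆ := by
        rw [smul_smul, mul_assoc _ (intSign K (B a d)), s1, mul_one]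
    _ = _ := by
        rw [hJ, smul_smul]
        congr 1
        linear_combination (intSign K (B a b) * intSign K (B a d)) * s2

/-- Here `d = x - a` is again a root, positive after possibly exchanging the two decompositions.
Then `x = a + d` and `b = d + y`, and associativity applies to `a, d, y`. -/
theorem decompVec_eq_of_form_eq_one {n : ℤ} (ih : G.PosVecGood B n) {z x y a b : Λ}
    (hn : G.ht z ≤ n + 1) (hxy : G.IsPosDecomp z (x, y)) (hab : G.IsPosDecomp z (a, b))
    (hxa : G.form x a = 1) : G.decompVec B x y = G.decompVec B a b := by
  wlog hlt : 0 < G.ht (x - a) generalizing x y a b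
  · refine (this hab hxy (by rw [G.form_comm, hxa]) ?_).symm
    have hd : G.form (x - a) (x - a) = 2 := by
      rw [form_sub_self, hxy.1, hab.1, hxa]; norm_num
    have := G.ht_ne_zero _ hd
    rw [← neg_sub, map_neg]
    omega
  obtain ⟨hx, hy, hx0, hy0, hxy, hsum⟩ := hxy
  obtain ⟨ha, hb, ha0, hb0, hab, hsum'⟩ := hab
  dsimp only at *
  have haz : G.form a z = 1 := by rw [← hsum', map_add]; omega
  have hax := G.form_comm a x
  have hay : G.form a y = 0 := by rw [← hsum, map_add] at haz; omega
  have key := decompVec_assoc ih (a := a) (d := x - a) (b := y) ha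
    (by rw [form_sub_self]; omega) hy ha0 hlt hy0
    (by rw [← map_add, ← map_add, add_sub_cancel, hsum]; exact hn) (by rw [map_sub]; omega)
    (by rw [map_sub, LinearMap.sub_apply]; omega) hay
  have hb' : x - a + y = b := by rw [← add_sub_right_comm, hsum, ← hsum', add_sub_cancel_left]
  rwa [add_sub_cancel, hb'] at key

/-- Since `(x, a) + (x, b) = (x, z) = 1` with both terms at least `-1`, one of them is 1 or 2. The
value 2 means equality of roots, the value 1 is the previous lemma, and exchanging `a` and `b` is
harmless. -/
theorem decompVec_eq (hB : ∀ x y, B x y + B y x = G.form x y) {n : ℤ} (ih : G.PosVecGood B n)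
    {z x y a b : Λ} (hn : G.ht z ≤ n + 1) (hxy : G.IsPosDecomp z (x, y))
    (hab : G.IsPosDecomp z (a, b)) : G.decompVec B x y = G.decompVec B a b := by
  have hba : G.IsPosDecomp z (b, a) :=
    ⟨hab.2.1, hab.1, hab.2.2.2.1, hab.2.2.1, by rw [G.form_comm]; exact hab.2.2.2.2.1,
      by rw [add_comm]; exact hab.2.2.2.2.2⟩
  have hcomm := decompVec_comm hB hab.2.2.2.2.1
  have eq_of : ∀ {c d}, G.IsPosDecomp z (c, d) → x = c →
      G.decompVec B x y = G.decompVec B c d := by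
    rintro c d h rfl
    rw [show y = d from add_left_cancel (hxy.2.2.2.2.2.trans h.2.2.2.2.2.symm)]
  have sum : G.form x a + G.form x b = 1 := by
    rw [← map_add, hab.2.2.2.2.2, ← hxy.2.2.2.2.2, map_add]
    have := hxy.1
    have := hxy.2.2.2.2.1
    dsimp only at *
    omega
  have ge : ∀ c, G.form c c = 2 → 0 < G.ht c → -1 ≤ G.form x c := fun c hc hc0 ↦
    G.neg_one_le_form hxy.1 hc fun h ↦ by
      have := congrArg G.ht h
      rw [map_add, map_zero] at this
      have := hxy.2.2.1
      dsimp only at *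
      omega
  have eq_of_two : ∀ c, G.form c c = 2 → G.form x c = 2 → x = c := fun c hc h ↦
    sub_eq_zero.1 <| G.eq_zero_of_form_self_eq_zero <| by
      rw [form_sub_self, hxy.1, hc, h]; norm_num
  have h1 := ge a hab.1 hab.2.2.1
  have h2 := ge b hba.1 hba.2.2.1
  obtain h | h | h | h : G.form x a = 2 ∨ G.form x a = 1 ∨ G.form x b = 1 ∨ G.form x b = 2 := by
    omega
  · exact eq_of hab (eq_of_two a hab.1 h)
  · exact decompVec_eq_of_form_eq_one ih hn hxy hab h
  · exact (decompVec_eq_of_form_eq_one ih hn hxy hba h).trans hcomm.symm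
  · exact (eq_of hba (eq_of_two b hba.1 h)).trans hcomm.symm

theorem posVecGood (hB : ∀ x y, B x y + B y x = G.form x y) (n : ℕ) : G.PosVecGood B n := by
  induction n with
  | zero => intro z _ h1 h2; simp at h2; omega
  | succ n ih =>
    intro z hz hz0 hzn
    push_cast at hzn
    by_cases h : ∃ p, G.IsPosDecomp z p
    · obtain ⟨x, y, hp, hdef⟩ : ∃ x y, G.IsPosDecomp z (x, y) ∧
          G.posVec B z = G.decompVec B x y :=
        ⟨h.choose.1, h.choose.2, h.choose_spec, by rw [posVec, dif_pos h]; rfl⟩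
      refine ⟨?_, fun a b hab ↦ by rw [hdef, decompVec_eq hB ih hzn hp hab]⟩
      obtain ⟨hx, hy, hx0, hy0, hxy, hsum⟩ := hp
      have hht := congrArg G.ht hsum
      dsimp only at *
      rw [map_add] at hht
      obtain ⟨⟨hmx, hx1⟩, -⟩ := ih x hx hx0 (by omega)
      obtain ⟨⟨hmy, hy1⟩, -⟩ := ih y hy hy0 (by omega)
      rw [hdef]
      refine ⟨Submodule.smul_mem _ _ (hsum ▸ G.lie_mem hmx hmy),
        smul_ne_zero (intSign_ne_zero _) (G.lie_ne_zero hx hy hxy hmx hx1 hmy hy1)⟩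
    -- An indecomposable root imposes no condition, so any nonzero root vector serves.
    · have hdef : G.posVec B z = (G.exists_lie_eq z hz).choose := by
        rw [posVec, dif_neg h, dif_pos hz]
      refine ⟨?_, fun x y hxy ↦ (h ⟨_, hxy⟩).elim⟩
      rw [hdef]
      exact ⟨(G.exists_lie_eq z hz).choose_spec.1, (G.exists_lie_eq z hz).choose_spec.2.1⟩

theorem posVec_spec (hB : ∀ x y, B x y + B y x = G.form x y) {z : Λ} (hz : G.form z z = 2)
    (hz0 : 0 < G.ht z) : G.posVec B z ∈ G.part z ∧ G.posVec B z ≠ 0 :=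
  (posVecGood hB (G.ht z).toNat z hz hz0 (by omega)).1

theorem lie_posVec (hB : ∀ x y, B x y + B y x = G.form x y) {x y : Λ} (hx : G.form x x = 2)
    (hy : G.form y y = 2) (hx0 : 0 < G.ht x) (hy0 : 0 < G.ht y) (h : G.form x y = -1) :
    ⁅G.posVec B x, G.posVec B y⁆ = intSign K (B x y) • G.posVec B (x + y) :=
  lie_posVec_eq <| (posVecGood hB (G.ht (x + y)).toNat (x + y) (G.form_add_self_eq_two hx hy h)
    (by rw [map_add]; omega) (by omega)).2 x y ⟨hx, hy, hx0, hy0, h, rfl⟩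

/-! ### Chevalley systems -/

variable (G)

/-- A choice of root vectors `e x`, such that `e x` and `e (-x)` are dual to each other. -/
structure IsRootVectorSystem (e : Λ → L) : Prop where
  mem : ∀ x, G.form x x = 2 → e x ∈ G.part x
  ne_zero : ∀ x, G.form x x = 2 → e x ≠ 0
  lie_neg : ∀ x, G.form x x = 2 → ⁅e x, e (-x)⁆ = -G.t x

variable {G}

namespace IsRootVectorSystem

variable {e : Λ → L}

theorem exists_lie_eq (he : G.IsRootVectorSystem e) {x y : Λ} (hx : G.form x x = 2)
    (hy : G.form y y = 2) (h : G.form x y = -1) : ∃ c : K, ⁅e x, e y⁆ = c • e (x + y) := by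
  have h2 := G.form_add_self_eq_two hx hy h
  exact G.exists_smul_eq _ h2 _ (he.mem _ h2) (he.ne_zero _ h2) _
    (G.lie_mem (he.mem _ hx) (he.mem _ hy))

/-- The structure constants are invariant under cyclic rotation of roots with sum zero. -/
theorem lie_rotate [CharZero K] (he : G.IsRootVectorSystem e) {x y : Λ} (hx : G.form x x = 2)
    (hy : G.form y y = 2) (h : G.form x y = -1) {a : K} (ha : ⁅e x, e y⁆ = a • e (x + y)) :
    ⁅e y, e (-(x + y))⁆ = a • e (-x) := by
  have hyx := G.form_comm y x
  have h2 := G.form_add_self_eq_two hx hy h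
  have hz : G.form (-(x + y)) (-(x + y)) = 2 := by rw [form_neg_self, h2]
  have hyz : G.form y (-(x + y)) = -1 := by rw [map_neg, map_add]; omega
  have hxz : G.form x (-(x + y)) = -1 := by rw [map_neg, map_add]; omega
  obtain ⟨b, hb⟩ := he.exists_lie_eq hy hz hyz
  obtain ⟨c, hc⟩ := he.exists_lie_eq hx hz hxz
  rw [show y + -(x + y) = -x by abel] at hb
  rw [show x + -(x + y) = -y by abel] at hc
  -- Jacobi gives `b • t x = a • t (x + y) + c • t y`. Acting on `e x` and `e y` yields two scalar
  -- equations, and eliminating `c` leaves `3 * (b - a) = 0`.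
  have hJ := leibniz_lie (e x) (e y) (e (-(x + y)))
  rw [ha, hb, hc, lie_smul, smul_lie, lie_smul, he.lie_neg x hx, he.lie_neg y hy,
    he.lie_neg _ h2, map_add] at hJ
  have hJx := congrArg (fun v ↦ ⁅v, e x⁆) hJ
  have hJy := congrArg (fun v ↦ ⁅v, e y⁆) hJ
  simp only [smul_lie, neg_lie, add_lie, G.t_lie _ (he.mem x hx), G.t_lie _ (he.mem y hy),
    hx, hy, h, hyx, smul_smul, ← add_smul, ← neg_smul] at hJx hJy
  have e1 := smul_left_injective K (he.ne_zero x hx) hJx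
  have e2 := smul_left_injective K (he.ne_zero y hy) hJy
  push_cast at e1 e2
  have : (3 : K) * (b - a) = 0 := by linear_combination -2 * e1 - e2
  have hba : b - a = 0 := (mul_eq_zero.1 this).resolve_left (by norm_num)
  rw [hb, sub_eq_zero.1 hba]

/-- The structure constants of opposite pairs are inverse to each other. -/
theorem lie_neg_neg [CharZero K] (he : G.IsRootVectorSystem e) {x y : Λ} (hx : G.form x x = 2)
    (hy : G.form y y = 2) (h : G.form x y = -1) {a b : K} (ha : ⁅e x, e y⁆ = a • e (x + y))
    (hb : ⁅e (-x), e (-y)⁆ = b • e (-x + -y)) : a * b = 1 := by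
  have hnx : G.form (-x) (-x) = 2 := by rw [form_neg_self, hx]
  have hny : G.form (-y) (-y) = 2 := by rw [form_neg_self, hy]
  have h' : G.form (-x) (-y) = -1 := by simp [h]
  -- Rotation evaluates `[e (-x), e (x + y)]` as `-b • e y`. Hence `[e (-x), [e x, e y]]` is `-a *
  -- b` times `e y`, while the Leibniz rule gives `[t x, e y] = -e y`.
  have hrot := he.lie_rotate hny hnx (by rw [G.form_comm, h']) (a := -b)
    (by rw [← lie_skew, hb, neg_smul, add_comm (-y)])
  rw [show -(-y + -x) = x + y by abel, neg_neg] at hrot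
  have h0 : ⁅e (-x), e y⁆ = 0 :=
    G.lie_eq_zero hnx hy (by simp [h]) (he.mem _ hnx) (he.mem _ hy)
  have hxx : ⁅e (-x), e x⁆ = G.t x := by
    have := he.lie_neg (-x) hnx
    simpa using this
  have hJ := leibniz_lie (e (-x)) (e x) (e y)
  rw [ha, h0, lie_zero, add_zero, lie_smul, hrot, hxx, G.t_lie x (he.mem y hy), h, smul_smul] at hJ
  have := smul_left_injective K (he.ne_zero y hy) hJ
  push_cast at this
  linear_combination -this

end IsRootVectorSystem

variable (G) in
/-- Every simply laced grading admits root vectors with structure constants `(-1) ^ B x y`. -/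
theorem exists_chevalley_system [CharZero K] (hB : ∀ x y, B x y + B y x = G.form x y) :
    ∃ e : Λ → L, G.IsRootVectorSystem e ∧ ∀ x y, G.form x x = 2 → G.form y y = 2 →
      G.form x y = -1 → ⁅e x, e y⁆ = intSign K (B x y) • e (x + y) := by
  classical
  -- Vectors for negative roots are fixed by duality with the positive ones; as `t x = -t (-x)`,
  -- this is the normalization of `IsRootVectorSystem`.
  have hdual : ∀ x, ∃ v : L, G.form x x = 2 → 0 < G.ht (-x) → v ∈ G.part x ∧
      ⁅G.posVec B (-x), v⁆ = G.t x := by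
    intro x
    by_cases hx : G.form x x = 2
    · by_cases hx0 : 0 < G.ht (-x)
      · have hnx : G.form (-x) (-x) = 2 := by rw [form_neg_self, hx]
        obtain ⟨hm, hne⟩ := posVec_spec hB hnx hx0
        obtain ⟨v, hv, h⟩ := G.exists_lie_eq_t hnx hm hne
        rw [neg_neg] at hv
        exact ⟨-v, fun _ _ ↦ ⟨neg_mem hv, by rw [lie_neg, h, map_neg, neg_neg]⟩⟩
      · exact ⟨0, fun _ h ↦ absurd h hx0⟩
    · exact ⟨0, fun h ↦ absurd h hx⟩
  choose d hd using hdual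
  let e : Λ → L := fun x ↦ if 0 < G.ht x then G.posVec B x else d x
  have hpos : ∀ x, 0 < G.ht x → e x = G.posVec B x := fun x h ↦ if_pos h
  have hneg : ∀ x, 0 < G.ht (-x) → e x = d x := fun x h ↦ if_neg (by rw [map_neg] at h; omega)
  have hcases : ∀ x, G.form x x = 2 → 0 < G.ht x ∨ 0 < G.ht (-x) := fun x hx ↦ by
    have := G.ht_ne_zero x hx
    rw [map_neg]
    omega
  have ht2 : ∀ x, G.form x x = 2 → G.t x ≠ 0 := fun x hx h ↦ by
    obtain ⟨u, hu, hu0, -⟩ := G.exists_lie_eq x hx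
    have := G.t_lie x hu
    rw [h, zero_lie, hx, eq_comm, smul_eq_zero] at this
    simp [hu0] at this
  have he : G.IsRootVectorSystem e := by
    have hmem : ∀ x, G.form x x = 2 → e x ∈ G.part x := by
      intro x hx
      rcases hcases x hx with h | h
      · rw [hpos x h]; exact (posVec_spec hB hx h).1
      · rw [hneg x h]; exact (hd x hx h).1
    have hlie : ∀ x, G.form x x = 2 → ⁅e x, e (-x)⁆ = -G.t x := by
      intro x hx
      have hnx : G.form (-x) (-x) = 2 := by rw [form_neg_self, hx]
      rcases hcases x hx with h | h
      · have := hd (-x) hnx (by rwa [neg_neg])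
        rw [hpos x h, hneg (-x) (by rwa [neg_neg])]
        simpa using this.2
      · rw [hpos (-x) h, hneg x h, ← lie_skew, (hd x hx h).2]
    refine ⟨hmem, fun x hx h ↦ ht2 x hx ?_, hlie⟩
    have := hlie x hx
    rwa [h, zero_lie, eq_comm, neg_eq_zero] at this
  refine ⟨e, he, ?_⟩
  -- For roots of mixed sign: among `x`, `y`, `-(x + y)` two have heights of the same sign, and `P`
  -- is preserved by cyclic rotation of this triple.
  let P : Λ → Λ → Prop := fun x y ↦ ⁅e x, e y⁆ = intSign K (B x y) • e (x + y)
  have hpp : ∀ x y, G.form x x = 2 → G.form y y = 2 → G.form x y = -1 → 0 < G.ht x →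
      0 < G.ht y → P x y := fun x y hx hy h hx0 hy0 ↦ by
    change ⁅e x, e y⁆ = _
    rw [hpos x hx0, hpos y hy0, hpos (x + y) (by rw [map_add]; omega),
      lie_posVec hB hx hy hx0 hy0 h]
  have hnn : ∀ x y, G.form x x = 2 → G.form y y = 2 → G.form x y = -1 → G.ht x < 0 →
      G.ht y < 0 → P x y := fun x y hx hy h hx0 hy0 ↦ by
    have h1 := hpp (-x) (-y) (by simp [hx]) (by simp [hy]) (by simp [h])
      (by rw [map_neg]; omega) (by rw [map_neg]; omega)
    obtain ⟨c, hc⟩ := he.exists_lie_eq hx hy h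
    have h2 := he.lie_neg_neg hx hy h hc h1
    simp only [map_neg, LinearMap.neg_apply, neg_neg] at h2
    change ⁅e x, e y⁆ = _
    rw [hc]
    congr 1
    calc c = c * (intSign K (B x y) * intSign K (B x y)) := by rw [intSign_mul_self, mul_one]
      _ = _ := by rw [← mul_assoc, h2, one_mul]
  -- Oddness of `B y y` gives `B y (-(x + y))` the parity of `B x y`, so the sign survives rotation.
  have hBself : ∀ x, G.form x x = 2 → B x x = 1 := fun x hx ↦ by
    have := hB x x
    omega
  have hrot : ∀ x y, G.form x x = 2 → G.form y y = 2 → G.form x y = -1 → P x y →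
      P y (-(x + y)) := fun x y hx hy h hP ↦ by
    have h1 := he.lie_rotate hx hy h hP
    change ⁅e y, e (-(x + y))⁆ = _
    rw [h1, show y + -(x + y) = -x by abel]
    congr 1
    rw [map_neg, map_add, hBself y hy, intSign_neg, intSign_add, intSign_one, intSign_form hB h]
    ring
  intro x y hx hy h
  have hyx := G.form_comm y x
  have h2 := G.form_add_self_eq_two hx hy h
  have hz : G.form (-(x + y)) (-(x + y)) = 2 := by rw [form_neg_self, h2]
  have hyz : G.form y (-(x + y)) = -1 := by rw [map_neg, map_add]; omega
  have hzx : G.form (-(x + y)) x = -1 := by rw [G.form_comm, map_neg, map_add]; omega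
  have r1 : P (-(x + y)) x → P x y := fun hP ↦ by
    simpa using hrot _ x hz hx hzx hP
  have r2 : P y (-(x + y)) → P x y := fun hP ↦ r1 <| by
    simpa using hrot y _ hy hz hyz hP
  have hx0 := G.ht_ne_zero x hx
  have hy0 := G.ht_ne_zero y hy
  have hz0 := G.ht_ne_zero _ hz
  rcases hx0.lt_or_gt with hx1 | hx1 <;> rcases hy0.lt_or_gt with hy1 | hy1
  · exact hnn x y hx hy h hx1 hy1
  · rcases hz0.lt_or_gt with hz1 | hz1
    · exact r1 (hnn _ x hz hx hzx hz1 hx1)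
    · exact r2 (hpp y _ hy hz hyz hy1 hz1)
  · rcases hz0.lt_or_gt with hz1 | hz1
    · exact r2 (hnn y _ hy hz hyz hy1 hz1)
    · exact r1 (hpp _ x hz hx hzx hz1 hx1)
  · exact hpp x y hx hy h hx1 hy1

end SimplyLacedGrading

/-! ### Automorphisms from lattice isometries -/

/-- A linear map factors through another one over a field if its kernel is larger. -/
theorem LinearMap.exists_comp_eq_of_ker_le {K V W U : Type*} [Field K] [AddCommGroup V] [Module K V]
    [AddCommGroup W] [Module K W] [AddCommGroup U] [Module K U] (f : V →ₗ[K] W) (g : V →ₗ[K] U)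
    (h : LinearMap.ker f ≤ LinearMap.ker g) : ∃ k : W →ₗ[K] U, k ∘ₗ f = g := by
  obtain ⟨s, hs⟩ := f.rangeRestrict.exists_rightInverse_of_surjective f.range_rangeRestrict
  obtain ⟨k, hk⟩ := LinearMap.exists_extend (g ∘ₗ s)
  refine ⟨k, LinearMap.ext fun v ↦ ?_⟩
  have h1 : k (f v) = g (s (f.rangeRestrict v)) := LinearMap.congr_fun hk (f.rangeRestrict v)
  have h2 : f (s (f.rangeRestrict v)) = f v :=
    congrArg Subtype.val (LinearMap.congr_fun hs (f.rangeRestrict v))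
  rw [LinearMap.comp_apply, h1, ← sub_eq_zero, ← map_sub]
  exact h (by rw [LinearMap.mem_ker, map_sub, h2, sub_self])

/-- Linear maps on the members of an independent family of submodules with supremum `⊤` are
restrictions of a single linear map. -/
theorem iSupIndep.exists_linearMap_eq {ι K V U : Type*} [Field K] [AddCommGroup V] [Module K V]
    [AddCommGroup U] [Module K U] {p : ι → Submodule K V} (hp : iSupIndep p) (htop : ⨆ i, p i = ⊤)
    (T : ι → V →ₗ[K] U) : ∃ f : V →ₗ[K] U, ∀ i, ∀ v ∈ p i, f v = T i v := by
  classical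
  have hint : DirectSum.IsInternal p :=
    DirectSum.isInternal_submodule_of_iSupIndep_of_iSup_eq_top hp htop
  let E := LinearEquiv.ofBijective (DirectSum.coeLinearMap p) hint
  refine ⟨(DirectSum.toModule K ι U fun i ↦ T i ∘ₗ (p i).subtype) ∘ₗ E.symm.toLinearMap,
    fun i v hv ↦ ?_⟩
  have : E.symm v = DirectSum.lof K ι (fun i ↦ p i) i ⟨v, hv⟩ := by
    rw [LinearEquiv.symm_apply_eq]
    exact (DirectSum.coeLinearMap_lof p i ⟨v, hv⟩).symm
  simp [this]

namespace SimplyLacedGrading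

variable {K L Λ : Type*} [Field K] [LieRing L] [LieAlgebra K L] [AddCommGroup Λ]
  {G : SimplyLacedGrading K L Λ}

theorem IsRootVectorSystem.span_eq_top {e : Λ → L} (he : G.IsRootVectorSystem e) :
    Submodule.span K (Set.range G.t ∪ e '' {x | G.form x x = 2}) = ⊤ := by
  rw [eq_top_iff, ← G.iSup_part, iSup_le_iff]
  intro x
  by_cases hx : x = 0
  · rw [hx, G.part_zero]
    exact Submodule.span_mono Set.subset_union_left
  by_cases h2 : G.form x x = 2
  · intro v hv
    obtain ⟨c, rfl⟩ := G.exists_smul_eq x h2 _ (he.mem x h2) (he.ne_zero x h2) v hv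
    exact Submodule.smul_mem _ _ (Submodule.subset_span (Or.inr ⟨x, h2, rfl⟩))
  · rw [G.part_eq_bot x hx h2]
    exact bot_le

/-- A linear endomorphism acting on coroots through an isometry `w` of the lattice, and on given
root vectors through `w` and prescribed scalars. -/
theorem IsRootVectorSystem.exists_linearMap {e : Λ → L} (he : G.IsRootVectorSystem e)
    (w : Λ ≃ₗ[ℤ] Λ) (hw : ∀ x y, G.form (w x) (w y) = G.form x y) (c : Λ → K) :
    ∃ f : L →ₗ[K] L, (∀ x, f (G.t x) = G.t (w x)) ∧
      ∀ x, G.form x x = 2 → f (e x) = c x • e (w x) := by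
  classical
  -- Linear relations among the `t x` are detected by the form, which `w` preserves, so `t x ↦ t (w
  -- x)` is well defined on the span.
  obtain ⟨T₀, hT₀⟩ := LinearMap.exists_comp_eq_of_ker_le
    (Finsupp.linearCombination K fun x ↦ G.t x) (Finsupp.linearCombination K fun x ↦ G.t (w x))
    (by
      intro a ha
      rw [LinearMap.mem_ker, Finsupp.linearCombination_apply] at ha ⊢
      rw [G.t_comb_eq_zero_iff] at ha
      have h := (G.t_comb_eq_zero_iff (a.mapDomain w)).2 fun y ↦ by
        obtain ⟨y, rfl⟩ := w.surjective y
        rw [Finsupp.sum_mapDomain_index (by simp) (by simp [add_mul])]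
        simpa only [hw] using ha y
      rwa [Finsupp.sum_mapDomain_index (by simp) (by simp [add_smul])] at h)
  have hroot : ∀ x, ∃ T : L →ₗ[K] L, G.form x x = 2 → T (e x) = c x • e (w x) := by
    intro x
    by_cases hx : G.form x x = 2
    · obtain ⟨T, hT⟩ := LinearMap.exists_comp_eq_of_ker_le
        (LinearMap.toSpanSingleton K L (e x)) (LinearMap.toSpanSingleton K L (c x • e (w x)))
        (by rw [LinearMap.ker_toSpanSingleton K (he.ne_zero x hx)]; exact bot_le)
      exact ⟨T, fun _ ↦ by simpa using LinearMap.congr_fun hT 1⟩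
    · exact ⟨0, fun h ↦ absurd h hx⟩
  choose T hT using hroot
  obtain ⟨f, hf⟩ := G.iSupIndep_part.exists_linearMap_eq G.iSup_part
    fun x ↦ if x = 0 then T₀ else T x
  refine ⟨f, fun x ↦ ?_, fun x hx ↦ ?_⟩
  · rw [hf 0 _ (G.t_mem x), if_pos rfl]
    simpa using LinearMap.congr_fun hT₀ (Finsupp.single x 1)
  · rw [hf x _ (he.mem x hx), if_neg (by rintro rfl; simp at hx), hT x hx]

theorem form_eq_cases {x y : Λ} (hx : G.form x x = 2) (hy : G.form y y = 2) :
    y = -x ∨ G.form x y = -1 ∨ 0 ≤ G.form x y := by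
  by_cases h : x + y = 0
  · exact Or.inl (eq_neg_of_add_eq_zero_right h)
  · have := G.neg_one_le_form hx hy h
    omega

/-- An isometry `w` of the lattice and a compatible choice of scalars define a Lie algebra
automorphism. -/
theorem IsRootVectorSystem.exists_lieEquiv [FiniteDimensional K L] {e : Λ → L}
    (he : G.IsRootVectorSystem e) {B C : LinearMap.BilinForm ℤ Λ}
    (heB : ∀ x y, G.form x x = 2 → G.form y y = 2 → G.form x y = -1 →
      ⁅e x, e y⁆ = intSign K (B x y) • e (x + y))
    (w : Λ ≃ₗ[ℤ] Λ) (hw : ∀ x y, G.form (w x) (w y) = G.form x y)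
    (hC : ∀ x y, C x y - C y x = B (w x) (w y) - B x y) :
    ∃ σ : L ≃ₗ⁅K⁆ L, (∀ x, σ (G.t x) = G.t (w x)) ∧
      ∀ x, G.form x x = 2 → σ (e x) = intSign K (C x x) • e (w x) := by
  obtain ⟨f, hft, hfe⟩ := he.exists_linearMap w hw fun x ↦ intSign K (C x x)
  have hw2 : ∀ x, G.form x x = 2 → G.form (w x) (w x) = 2 := fun x hx ↦ by rw [hw, hx]
  have hte : ∀ x y, G.form y y = 2 → f ⁅G.t x, e y⁆ = ⁅f (G.t x), f (e y)⁆ := fun x y hy ↦ by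
    rw [G.t_lie x (he.mem y hy), map_smul, hft, hfe y hy, lie_smul,
      G.t_lie _ (he.mem _ (hw2 y hy)), hw, smul_comm]
  have hee : ∀ x y, G.form x x = 2 → G.form y y = 2 → f ⁅e x, e y⁆ = ⁅f (e x), f (e y)⁆ := by
    intro x y hx hy
    rw [hfe x hx, hfe y hy, lie_smul, smul_lie, smul_smul]
    rcases G.form_eq_cases hx hy with rfl | h | h
    · rw [he.lie_neg x hx, map_neg, hft, map_neg w, he.lie_neg _ (hw2 x hx)]
      simp [intSign_mul_self]
    · rw [heB x y hx hy h, map_smul, hfe _ (G.form_add_self_eq_two hx hy h),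
        heB _ _ (hw2 x hx) (hw2 y hy) (by rw [hw, h]), smul_smul, smul_smul, map_add w]
      congr 1
      -- Expanding `C (x + y) (x + y)` leaves the cross terms `C x y + C y x`, congruent modulo 2 to
      -- `C x y - C y x`, the change of `B`.
      rw [← intSign_add, ← intSign_add, ← intSign_add]
      apply intSign_of_modEq
      have := hC x y
      simp only [map_add, LinearMap.add_apply]
      rw [Int.modEq_iff_dvd]
      exact ⟨-C y x + (B (w x) (w y) - C x y + C y x - B x y), by linarith⟩
    · rw [G.lie_eq_zero hx hy h (he.mem x hx) (he.mem y hy), map_zero,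
        G.lie_eq_zero (hw2 x hx) (hw2 y hy) (by rwa [hw]) (he.mem _ (hw2 x hx))
          (he.mem _ (hw2 y hy)), smul_zero]
  have hlie : ∀ u v, f ⁅u, v⁆ = ⁅f u, f v⁆ := by
    suffices h : ∀ u v, u ∈ Submodule.span K (Set.range G.t ∪ e '' {x | G.form x x = 2}) →
        v ∈ Submodule.span K (Set.range G.t ∪ e '' {x | G.form x x = 2}) →
        f ⁅u, v⁆ = ⁅f u, f v⁆ from
      fun u v ↦ h u v (by rw [he.span_eq_top]; trivial) (by rw [he.span_eq_top]; trivial)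
    intro u v hu hv
    induction hu, hv using Submodule.span_induction₂ with
    | mem_mem u v hu hv =>
      rcases hu with ⟨x, rfl⟩ | ⟨x, hx, rfl⟩ <;> rcases hv with ⟨y, rfl⟩ | ⟨y, hy, rfl⟩
      · rw [G.t_lie_t, hft, hft, G.t_lie_t, map_zero]
      · exact hte x y hy
      · rw [← lie_skew, map_neg, hte y x hx, lie_skew]
      · exact hee x y hx hy
    | zero_left v hv => simp
    | zero_right u hu => simp
    | add_left u v z hu hv hz h1 h2 => simp [h1, h2]
    | add_right u v z hu hv hz h1 h2 => simp [h1, h2]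
    | smul_left r u v hu hv h => simp [h]
    | smul_right r u v hu hv h => simp [h]
  have hsurj : Function.Surjective f := by
    rw [← LinearMap.range_eq_top, eq_top_iff, ← he.span_eq_top, Submodule.span_le]
    rintro _ (⟨x, rfl⟩ | ⟨x, hx, rfl⟩)
    · exact ⟨G.t (w.symm x), by rw [hft, w.apply_symm_apply]⟩
    · have hx' : G.form (w.symm x) (w.symm x) = 2 := by
        rw [← hw, w.apply_symm_apply]; exact hx
      refine ⟨intSign K (C (w.symm x) (w.symm x)) • e (w.symm x), ?_⟩
      rw [map_smul, hfe _ hx', smul_smul, intSign_mul_self, one_smul, w.apply_symm_apply]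
  let g : L →ₗ⁅K⁆ L := { f with map_lie' := hlie _ _ }
  exact ⟨LieEquiv.ofBijective g ⟨LinearMap.injective_iff_surjective.2 hsurj, hsurj⟩, hft, hfe⟩

theorem t_injective [CharZero K] : Function.Injective G.t := by
  rw [injective_iff_map_eq_zero]
  intro x hx
  have h := (G.t_comb_eq_zero_iff (Finsupp.single x 1)).1 (by simp [hx]) x
  simp only [Finsupp.sum_single_index, zero_mul, one_mul, Int.cast_eq_zero] at h
  exact G.eq_zero_of_form_self_eq_zero h

variable (G) in
/-- Every elliptic isometry of the lattice lifts to a Lie algebra automorphism of the same order. -/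
theorem exists_lieEquiv_orderOf_eq [CharZero K] [FiniteDimensional K L] [Module.Free ℤ Λ]
    (w : Λ ≃ₗ[ℤ] Λ) (hw : ∀ x y, G.form (w x) (w y) = G.form x y) (hell : IsEllipticAut w) :
    ∃ σ : L ≃ₗ⁅K⁆ L, (∀ x, σ (G.t x) = G.t (w x)) ∧
      orderOf (σ.toLinearEquiv : L ≃ₗ[K] L) = orderOf w := by
  obtain ⟨B, hB⟩ := exists_add_flip_eq_of_even G.form G.form_comm G.form_even
  obtain ⟨e, he, heB⟩ := G.exists_chevalley_system hB
  obtain ⟨C, hC⟩ := exists_sub_flip_eq_of_alternating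
    (B.compl₁₂ w.toLinearMap w.toLinearMap - B) fun x ↦ by
      have h1 := hB x x
      have h2 := hB (w x) (w x)
      rw [hw] at h2
      simp only [LinearMap.sub_apply, LinearMap.compl₁₂_apply, LinearEquiv.coe_coe]
      omega
  replace hC : ∀ x y, C x y - C y x = B (w x) (w y) - B x y := hC
  obtain ⟨σ, hσt, hσe⟩ := he.exists_lieEquiv heB w hw hC
  have hwn : ∀ (n : ℕ) x, G.form ((w ^ n) x) ((w ^ n) x) = G.form x x := fun n x ↦ by
    induction n with
    | zero => simp
    | succ n ih => rw [pow_succ', LinearEquiv.mul_apply, hw, ih]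
  have hpt : ∀ (n : ℕ) x, (σ.toLinearEquiv ^ n) (G.t x) = G.t ((w ^ n) x) := fun n x ↦ by
    induction n with
    | zero => simp
    | succ n ih =>
      rw [pow_succ', LinearEquiv.mul_apply, ih, pow_succ' w, LinearEquiv.mul_apply]
      exact hσt _
  have hpe : ∀ (n : ℕ) x, G.form x x = 2 → (σ.toLinearEquiv ^ n) (e x) =
      intSign K (∑ i ∈ Finset.range n, C ((w ^ i) x) ((w ^ i) x)) • e ((w ^ n) x) := by
    intro n x hx
    induction n with
    | zero => simp
    | succ n ih =>
      rw [pow_succ', LinearEquiv.mul_apply, ih, map_smul, Finset.sum_range_succ, intSign_add,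
        mul_smul, pow_succ' w, LinearEquiv.mul_apply]
      congr 1
      exact hσe _ ((hwn n x).trans hx)
  refine ⟨σ, hσt, orderOf_eq_orderOf_iff.2 fun n ↦ ⟨fun h ↦ ?_, fun h ↦ ?_⟩⟩
  · ext x
    apply G.t_injective
    rw [← hpt, h]
    rfl
  · have hsign : ∀ x, intSign K (∑ i ∈ Finset.range n, C ((w ^ i) x) ((w ^ i) x)) = 1 := by
      intro x
      have h1 := diag_sum_orbit_modEq w B C hC x n
      have : IsAddTorsionFree Λ := .of_isTorsionFree ℤ Λ
      rw [hell.sum_pow_apply_eq_zero h x] at h1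
      simp only [map_zero, LinearMap.zero_apply, sub_zero, add_zero] at h1
      rw [← intSign_of_modEq h1, intSign_zero]
    apply LinearEquiv.toLinearMap_injective
    refine LinearMap.ext_on he.span_eq_top ?_
    rintro _ (⟨x, rfl⟩ | ⟨x, hx, rfl⟩)
    · exact (hpt n x).trans (by rw [h]; rfl)
    · exact (hpe n x hx).trans (by rw [hsign, one_smul, h]; rfl)

end SimplyLacedGrading

/-! ### The root lattice: evenness, positivity, vectors of norm two -/

namespace RootPairing

variable {ι K M N : Type*} [Field K] [AddCommGroup M] [Module K M]
  [AddCommGroup N] [Module K N] {P : RootPairing ι K M N}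

variable (P) in
/-- The sum in the root lattice of a multiset of roots. -/
def rootSum (s : Multiset ι) : P.rootSpan ℤ := (s.map (P.rootSpanMem ℤ)).sum

@[simp] theorem rootSum_cons (i : ι) (s : Multiset ι) :
    P.rootSum (i ::ₘ s) = P.rootSpanMem ℤ i + P.rootSum s := by simp [rootSum]

/-- Negatives of roots are roots (`reflectionPerm i i` is the index of the negative), so no integer
coefficients are needed. -/
theorem exists_rootSum_eq (x : P.rootSpan ℤ) : ∃ s, P.rootSum s = x := by
  have hadd : ∀ s t, P.rootSum (s + t) = P.rootSum s + P.rootSum t := by simp [rootSum]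
  obtain ⟨x, hx⟩ := x
  suffices ∃ s, (P.rootSum s : M) = x from this.imp fun s hs ↦ Subtype.ext hs
  induction hx using Submodule.span_induction with
  | mem x hx =>
    obtain ⟨i, rfl⟩ := hx
    exact ⟨{i}, by simp [rootSum]⟩
  | zero => exact ⟨0, by simp [rootSum]⟩
  | add x y _ _ hx hy =>
    obtain ⟨s, rfl⟩ := hx
    obtain ⟨t, rfl⟩ := hy
    exact ⟨s + t, by rw [hadd]; rfl⟩
  | smul n x _ hx =>
    obtain ⟨s, rfl⟩ := hx
    have hn : ∀ (n : ℕ) s, P.rootSum (n • s) = n • P.rootSum s := fun n s ↦ by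
      rw [rootSum, Multiset.map_nsmul, Multiset.sum_nsmul, rootSum]
    have hneg : P.rootSum (s.map fun i ↦ P.reflectionPerm i i) = -P.rootSum s := by
      rw [rootSum, rootSum, Multiset.map_map, ← Multiset.sum_map_neg', Multiset.map_map]
      simp only [Function.comp_def, rootSpanMem_reflectionPerm_self]
    obtain ⟨k, rfl | rfl⟩ := n.eq_nat_or_neg
    · exact ⟨k • s, by rw [hn]; simp⟩
    · exact ⟨k • s.map fun i ↦ P.reflectionPerm i i, by rw [hn, hneg]; simp⟩

variable [CharZero K] [P.IsCrystallographic] [Finite ι]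

theorem rootLatticeForm_rootLatticeProj (h : P.IsSimplyLaced) (c : ι →₀ ℤ) :
    rootLatticeForm h (P.rootLatticeProj c) = P.corootComb c := by
  have : (P.rootLatticeProj.quotKerEquivOfSurjective P.rootLatticeProj_surjective).symm
      (P.rootLatticeProj c) = (LinearMap.ker P.rootLatticeProj).mkQ c := by
    rw [LinearEquiv.symm_apply_eq, Submodule.mkQ_apply,
      LinearMap.quotKerEquivOfSurjective_apply_mk]
  rw [rootLatticeForm, LinearMap.comp_apply, LinearEquiv.coe_coe, this, Submodule.mkQ_apply,
    Submodule.liftQ_apply]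

theorem rootLatticeForm_comm (h : P.IsSimplyLaced) (x y : P.rootSpan ℤ) :
    rootLatticeForm h x y = rootLatticeForm h y x := by
  obtain ⟨c, rfl⟩ := P.rootLatticeProj_surjective x
  obtain ⟨d, rfl⟩ := P.rootLatticeProj_surjective y
  rw [rootLatticeForm_rootLatticeProj, rootLatticeForm_rootLatticeProj, h.corootComb_apply_comm]

theorem cast_rootLatticeForm_root (h : P.IsSimplyLaced) (i : ι) (x : P.rootSpan ℤ) :
    (rootLatticeForm h (P.rootSpanMem ℤ i) x : K) = P.coroot' i x := by
  have : rootLatticeForm h (P.rootSpanMem ℤ i) = P.coroot'In ℤ i := by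
    simpa [rootLatticeProj, corootComb] using
      rootLatticeForm_rootLatticeProj h (Finsupp.single i 1)
  rw [this, ← P.algebraMap_coroot'In_apply ℤ, eq_intCast]

theorem rootLatticeForm_add_self (h : P.IsSimplyLaced) (x y : P.rootSpan ℤ) :
    rootLatticeForm h (x + y) (x + y) =
      rootLatticeForm h x x + 2 * rootLatticeForm h x y + rootLatticeForm h y y := by
  simp only [map_add, LinearMap.add_apply, rootLatticeForm_comm h y x]
  ring

theorem even_rootLatticeForm_self (h : P.IsSimplyLaced) (x : P.rootSpan ℤ) :
    Even (rootLatticeForm h x x) := by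
  obtain ⟨s, rfl⟩ := P.exists_rootSum_eq x
  induction s using Multiset.induction_on with
  | empty => simp [rootSum]
  | cons i s ih =>
    rw [rootSum_cons, rootLatticeForm_add_self, rootLatticeForm_root_self]
    exact (even_two.add (even_two_mul _)).add ih

/-- Each summand contributes 2 to the norm and the cross terms are nonnegative. Removing `i` and `j`
from the multiset in `hs` allows for repeated roots. -/
theorem two_mul_card_le (h : P.IsSimplyLaced) (s : Multiset ι)
    (hs : ∀ i j s', s = i ::ₘ j ::ₘ s' → 0 ≤ P.pairingIn ℤ i j) :
    2 * (s.card : ℤ) ≤ rootLatticeForm h (P.rootSum s) (P.rootSum s) := by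
  induction s using Multiset.induction_on with
  | empty => simp [rootSum]
  | cons i s ih =>
    have h1 := ih fun j k s' hs' ↦ hs j k (i ::ₘ s') (by
      rw [hs', Multiset.cons_swap i j, Multiset.cons_swap i k])
    have h2 : 0 ≤ rootLatticeForm h (P.rootSpanMem ℤ i) (P.rootSum s) := by
      rw [rootSum, map_multiset_sum, Multiset.map_map]
      refine Multiset.sum_nonneg fun a ha ↦ ?_
      obtain ⟨j, hj, rfl⟩ := Multiset.mem_map.1 ha
      obtain ⟨s', rfl⟩ := Multiset.exists_cons_of_mem hj
      rw [Function.comp_apply, rootLatticeForm_root_root]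
      exact hs i j s' rfl
    rw [rootSum_cons, rootLatticeForm_add_self, rootLatticeForm_root_self, Multiset.card_cons]
    push_cast
    linarith

/-- Every element of the root lattice is a sum of roots forming pairwise non-obtuse angles; in
particular its norm is at least twice the number of summands. -/
theorem exists_rootSum_eq_two_mul_card_le (h : P.IsSimplyLaced) (x : P.rootSpan ℤ) :
    ∃ s, P.rootSum s = x ∧ 2 * (s.card : ℤ) ≤ rootLatticeForm h x x := by
  classical
  -- A shortest expression works: a pair with negative pairing is either opposite and cancels, or
  -- has a root as its sum, so the expression could be shortened.
  have hex : ∃ n, ∃ s : Multiset ι, P.rootSum s = x ∧ s.card = n :=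
    let ⟨s, hs⟩ := P.exists_rootSum_eq x
    ⟨s.card, s, hs, rfl⟩
  obtain ⟨s, rfl, hcard⟩ := Nat.find_spec hex
  refine ⟨s, rfl, two_mul_card_le h s ?_⟩
  rintro i j s' rfl
  by_contra! hneg
  rw [Multiset.card_cons, Multiset.card_cons] at hcard
  have hlt : ∀ t : Multiset ι, P.rootSum t = P.rootSum (i ::ₘ j ::ₘ s') → s'.card + 2 ≤ t.card :=
    fun t ht ↦ by
      have := Nat.find_min' hex ⟨t, ht, rfl⟩
      omega
  by_cases hij : P.root i = -P.root j
  · have := hlt s' (by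
      have h0 : P.rootSpanMem ℤ i + P.rootSpanMem ℤ j = 0 := Subtype.ext (by simp [hij])
      rw [rootSum_cons, rootSum_cons, ← add_assoc, h0, zero_add])
    omega
  · obtain ⟨k, hk⟩ := P.root_add_root_mem_of_pairingIn_neg hneg hij
    have := hlt (k ::ₘ s') (by
      have h0 : P.rootSpanMem ℤ i + P.rootSpanMem ℤ j = P.rootSpanMem ℤ k :=
        Subtype.ext (by simp [hk])
      rw [rootSum_cons, rootSum_cons, rootSum_cons, ← add_assoc, h0])
    rw [Multiset.card_cons] at this
    omega

theorem rootLatticeForm_self_pos (h : P.IsSimplyLaced) {x : P.rootSpan ℤ} (hx : x ≠ 0) :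
    0 < rootLatticeForm h x x := by
  obtain ⟨s, rfl, hs⟩ := exists_rootSum_eq_two_mul_card_le h x
  have : 0 < s.card := Multiset.card_pos.2 (by rintro rfl; simp [rootSum] at hx)
  omega

/-- The vectors of norm two in a simply laced root lattice are the roots. -/
theorem exists_rootSpanMem_eq (h : P.IsSimplyLaced) {x : P.rootSpan ℤ}
    (hx : rootLatticeForm h x x = 2) : ∃ i, P.rootSpanMem ℤ i = x := by
  obtain ⟨s, rfl, hs⟩ := exists_rootSum_eq_two_mul_card_le h x
  have hpos : 0 < s.card := Multiset.card_pos.2 (by rintro rfl; simp [rootSum] at hx)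
  obtain ⟨i, rfl⟩ := Multiset.card_eq_one.1 (show s.card = 1 by omega)
  exact ⟨i, by simp [rootSum]⟩

variable (P) in
theorem free_rootSpan [P.IsRootSystem] [P.IsReduced] : Module.Free ℤ (P.rootSpan ℤ) :=
  let ⟨b⟩ := P.nonempty_base
  .of_basis b.toWeightBasisInt

variable (P) in
/-- The height functional of a base separates the roots from zero. -/
theorem exists_dual_rootSpanMem_ne_zero [P.IsRootSystem] [P.IsReduced] :
    ∃ f : P.rootSpan ℤ →ₗ[ℤ] ℤ, ∀ i, f (P.rootSpanMem ℤ i) ≠ 0 := by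
  obtain ⟨b⟩ := P.nonempty_base
  refine ⟨b.toWeightBasisInt.constr ℤ fun _ ↦ 1, fun i ↦ ?_⟩
  obtain ⟨f, -, -, hf⟩ := b.exists_root_eq_sum_int i
  have : P.rootSpanMem ℤ i = ∑ j : b.support, f j • b.toWeightBasisInt j := by
    apply Subtype.ext
    simp only [AddSubmonoidClass.coe_finsetSum, Submodule.coe_smul,
      Base.coe_toWeightBasisInt_apply]
    rw [hf, ← Finset.sum_coe_sort]
  rw [this, map_sum]
  simp only [map_smul, Basis.constr_basis]
  have h2 := b.height_ne_zero i
  rw [b.height_eq_sum hf, ← Finset.sum_coe_sort] at h2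
  simpa using h2

end RootPairing

/-! ### The root space decomposition as a simply laced grading -/

namespace LieAlgebra.IsKilling

open RootPairing LieModule

variable {K L : Type*} [Field K] [CharZero K] [LieRing L] [LieAlgebra K L]
  [FiniteDimensional K L] [IsKilling K L] {H : LieSubalgebra K L} [H.IsCartanSubalgebra]
  [IsTriangularizable K H L]

/-- In a Killing Lie algebra the kernels of the weights on `H` meet only in zero, so the roots
separate points. -/
theorem eq_of_forall_rootLattice {h h' : H}
    (hh : ∀ μ : rootLattice H, (μ : Dual K H) h = (μ : Dual K H) h') : h = h' := by
  rw [← sub_eq_zero, ← Submodule.mem_bot K, ← iInf_ker_weight_eq_bot (K := K) (L := L) (H := H),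
    Submodule.mem_iInf]
  intro α
  by_cases hα : α.IsZero
  · change α (h - h') = 0
    rw [hα]; rfl
  · have := hh ((rootSystem H).rootSpanMem ℤ ⟨α, by simpa using hα⟩)
    change α h = α h' at this
    change Weight.toLinear K H L α (h - h') = 0
    rw [map_sub, sub_eq_zero]
    exact this

theorem exists_apply_eq_rootLatticeForm (hsl : (rootSystem H).IsSimplyLaced) (x : rootLattice H) :
    ∃ h : H, ∀ μ : rootLattice H, (μ : Dual K H) h = (rootLatticeForm hsl x μ : K) := by
  obtain ⟨s, rfl⟩ := exists_rootSum_eq x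
  induction s using Multiset.induction_on with
  | empty => exact ⟨0, by simp [rootSum]⟩
  | cons i s ih =>
    obtain ⟨h, hh⟩ := ih
    refine ⟨(rootSystem H).coroot i + h, fun μ ↦ ?_⟩
    rw [rootSum_cons, map_add, map_add, LinearMap.add_apply, Int.cast_add, hh,
      cast_rootLatticeForm_root]
    rfl

/-- The additive map from the root lattice of a simply laced Lie algebra to the Cartan subalgebra
that extends the passage from roots to coroots. -/
def corootHom (hsl : (rootSystem H).IsSimplyLaced) : rootLattice H →+ H :=
  AddMonoidHom.mk' (fun x ↦ (exists_apply_eq_rootLatticeForm hsl x).choose) fun x y ↦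
    eq_of_forall_rootLattice fun μ ↦ by
      refine ((exists_apply_eq_rootLatticeForm hsl (x + y)).choose_spec μ).trans ?_
      rw [map_add (rootLatticeForm hsl), LinearMap.add_apply, Int.cast_add,
        map_add (μ : Dual K H), (exists_apply_eq_rootLatticeForm hsl x).choose_spec,
        (exists_apply_eq_rootLatticeForm hsl y).choose_spec]

theorem apply_corootHom (hsl : (rootSystem H).IsSimplyLaced) (x μ : rootLattice H) :
    (μ : Dual K H) (corootHom hsl x) = (rootLatticeForm hsl x μ : K) :=
  (exists_apply_eq_rootLatticeForm hsl x).choose_spec μ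

theorem corootHom_rootSpanMem (hsl : (rootSystem H).IsSimplyLaced) (i : H.root) :
    corootHom hsl ((rootSystem H).rootSpanMem ℤ i) = coroot i.1 :=
  eq_of_forall_rootLattice fun μ ↦ by
    rw [apply_corootHom, cast_rootLatticeForm_root]
    rfl

theorem span_range_corootHom (hsl : (rootSystem H).IsSimplyLaced) :
    Submodule.span K (Set.range (corootHom hsl)) = ⊤ := by
  rw [eq_top_iff, ← IsRootSystem.span_coroot_eq_top (P := rootSystem H)]
  refine Submodule.span_mono ?_
  rintro _ ⟨i, rfl⟩
  exact ⟨_, corootHom_rootSpanMem hsl i⟩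

theorem sum_smul_corootHom_eq_zero_iff (hsl : (rootSystem H).IsSimplyLaced)
    (a : rootLattice H →₀ K) :
    (a.sum fun x k ↦ k • corootHom hsl x) = 0 ↔
      ∀ y, (a.sum fun x k ↦ k * (rootLatticeForm hsl x y : K)) = 0 := by
  have key : ∀ y : rootLattice H, (y : Dual K H) (a.sum fun x k ↦ k • corootHom hsl x) =
      a.sum fun x k ↦ k * (rootLatticeForm hsl x y : K) := fun y ↦ by
    simp only [Finsupp.sum, map_sum, map_smul, apply_corootHom, smul_eq_mul]
  simp_rw [← key]
  refine ⟨fun h y ↦ by rw [h, map_zero], fun h ↦ eq_of_forall_rootLattice fun μ ↦ ?_⟩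
  rw [h, map_zero]

/-- The root space decomposition of a simply laced Lie algebra, as a grading by the root lattice. -/
theorem exists_simplyLacedGrading (hsl : (rootSystem H).IsSimplyLaced) :
    ∃ G : SimplyLacedGrading K L (rootLattice H), G.form = rootLatticeForm hsl ∧
      ∀ x, G.t x = (corootHom hsl x : L) := by
  obtain ⟨f, hf⟩ := (rootSystem H).exists_dual_rootSpanMem_ne_zero
  have hroot : ∀ x : rootLattice H, rootLatticeForm hsl x x = 2 →
      ∃ α : Weight K H L, ∃ hα : α.IsNonZero,
        (rootSystem H).rootSpanMem ℤ ⟨α, by simpa using hα⟩ = x := fun x hx ↦ by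
    obtain ⟨⟨α, hα⟩, h⟩ := exists_rootSpanMem_eq hsl hx
    exact ⟨α, by simpa using hα, h⟩
  have hinj : Function.Injective fun x : rootLattice H ↦ ((x : Dual K H) : H → K) :=
    DFunLike.coe_injective.comp Subtype.val_injective
  refine ⟨{
    form := rootLatticeForm hsl
    form_comm := rootLatticeForm_comm hsl
    form_even := even_rootLatticeForm_self hsl
    form_pos := fun x ↦ rootLatticeForm_self_pos hsl
    ht := f
    ht_ne_zero := fun x hx ↦ by
      obtain ⟨i, rfl⟩ := exists_rootSpanMem_eq hsl hx
      exact hf i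
    part := fun x ↦ (rootSpace H (x : Dual K H)).toSubmodule
    lie_mem := fun hu hv ↦ lie_mem_genWeightSpace_of_mem_genWeightSpace hu hv
    part_eq_bot := fun x hx hx2 ↦ ?_
    exists_smul_eq := fun x hx u hu hu0 v hv ↦ ?_
    t := H.toSubmodule.subtype.toAddMonoidHom.comp (corootHom hsl)
    part_zero := ?_
    t_lie := fun x y v hv ↦ ?_
    exists_lie_eq := fun x hx ↦ ?_
    t_comb_eq_zero_iff := fun a ↦ ?_
    iSupIndep_part := ?_
    iSup_part := ?_ }, rfl, fun x ↦ rfl⟩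
  -- A nonzero part makes `x` a nonzero weight, hence a root, of norm 2.
  · by_contra h
    let α : Weight K H L := ⟨((x : Dual K H) : H → K), by simpa using h⟩
    have hα : α.IsNonZero := fun h0 ↦ hx (hinj h0)
    have : x = (rootSystem H).rootSpanMem ℤ ⟨α, by simpa using hα⟩ := hinj rfl
    rw [this, rootLatticeForm_root_self] at hx2
    exact hx2 rfl
  · obtain ⟨α, hα, rfl⟩ := hroot x hx
    have h1 := finrank_rootSpace_eq_one α hα
    obtain ⟨c, hc⟩ := (finrank_eq_one_iff_of_nonzero' (⟨u, hu⟩ : rootSpace H α)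
      fun h ↦ hu0 (congrArg Subtype.val h)).1 h1 ⟨v, hv⟩
    exact ⟨c, congrArg Subtype.val hc.symm⟩
  · have h0 : (rootSpace H ((0 : rootLattice H) : Dual K H)).toSubmodule = H.toSubmodule := by
      have := rootSpace_zero_eq K L H
      exact congrArg LieSubmodule.toSubmodule this
    have := congrArg (Submodule.map H.toSubmodule.subtype) (span_range_corootHom hsl)
    rw [Submodule.map_top, Submodule.range_subtype, Submodule.map_span, ← Set.range_comp] at this
    exact h0.trans this.symm
  · have := lie_eq_smul_of_mem_rootSpace hv (corootHom hsl x)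
    rw [apply_corootHom] at this
    exact this
  · obtain ⟨α, hα, rfl⟩ := hroot x hx
    obtain ⟨h, u, v, hs, hu, hv⟩ := exists_isSl2Triple_of_weight_isNonZero hα
    refine ⟨u, hu, hs.e_ne_zero, v, hv, ?_⟩
    rw [hs.lie_e_f, hs.h_eq_coroot hα hu hv, ← corootHom_rootSpanMem hsl ⟨α, by simpa using hα⟩]
    rfl
  · rw [← sum_smul_corootHom_eq_zero_iff, ← Submodule.coe_eq_zero (p := H.toSubmodule)]
    simp only [Finsupp.sum, AddSubmonoidClass.coe_finsetSum]
    rfl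
  · have := (LieSubmodule.iSupIndep_toSubmodule.2 (iSupIndep_genWeightSpace K H L)).comp hinj
    exact this
  · rw [eq_top_iff]
    have := congrArg LieSubmodule.toSubmodule (iSup_genWeightSpace_eq_top' K H L)
    rw [LieSubmodule.iSup_toSubmodule, LieSubmodule.top_toSubmodule] at this
    rw [← this, iSup_le_iff]
    intro α
    by_cases hα : α.IsZero
    · have h : genWeightSpace L (α : H → K) =
          genWeightSpace L (((0 : rootLattice H) : Dual K H) : H → K) := by rw [hα]; rfl
      rw [h]
      exact le_iSup (fun x : rootLattice H ↦ (rootSpace H (x : Dual K H)).toSubmodule) 0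
    · exact le_iSup (fun x : rootLattice H ↦ (rootSpace H (x : Dual K H)).toSubmodule)
        ((rootSystem H).rootSpanMem ℤ ⟨α, by simpa using hα⟩)

/-- The coroots span `H`, so the duality relation need only be checked on them, where it says that
`w` is an isometry. -/
theorem isLiftOf_of_apply_corootHom (hsl : (rootSystem H).IsSimplyLaced) {σ : L ≃ₗ⁅K⁆ L}
    {w : rootLattice H ≃ₗ[ℤ] rootLattice H} (hw : w ∈ rootLatticeAut hsl)
    (hσ : ∀ x, σ (corootHom hsl x) = (corootHom hsl (w x) : L)) : IsLiftOf H σ w := by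
  have hH : ∀ x : H, ∃ y : H, (y : L) = σ x ∧
      ∀ μ : rootLattice H, (w μ : Dual K H) y = (μ : Dual K H) x := by
    intro x
    have hx : x ∈ Submodule.span K (Set.range (corootHom hsl)) := by
      rw [span_range_corootHom]; trivial
    induction hx using Submodule.span_induction with
    | mem x hx =>
      obtain ⟨z, rfl⟩ := hx
      exact ⟨corootHom hsl (w z), (hσ z).symm, fun μ ↦ by
        rw [apply_corootHom, apply_corootHom, hw z μ]⟩
    | zero => exact ⟨0, by simp, by simp⟩
    | add x y _ _ hx hy =>
      obtain ⟨x', hx, hx'⟩ := hx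
      obtain ⟨y', hy, hy'⟩ := hy
      exact ⟨x' + y', by simp [hx, hy], fun μ ↦ by rw [map_add, map_add, hx', hy']⟩
    | smul c x _ hx =>
      obtain ⟨x', hx, hx'⟩ := hx
      exact ⟨c • x', by simp [hx], fun μ ↦ by rw [map_smul, map_smul, hx']⟩
  refine ⟨?_, fun μ x y hy ↦ ?_⟩
  · have hle : H.toSubmodule.map σ.toLinearEquiv.toLinearMap ≤ H.toSubmodule := by
      rintro _ ⟨x, hx, rfl⟩
      obtain ⟨y, hy, -⟩ := hH ⟨x, hx⟩
      exact hy ▸ y.2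
    rw [← LieSubalgebra.toSubmodule_inj]
    exact Submodule.eq_of_le_of_finrank_eq hle (LinearEquiv.finrank_map_eq σ.toLinearEquiv _)
  · obtain ⟨y', hy', h⟩ := hH x
    rw [Subtype.ext (hy.trans hy'.symm), h]

end LieAlgebra.IsKilling

end

/-- Every elliptic automorphism `w` of the root lattice of a simple, simply laced Lie algebra over
an algebraically closed field of characteristic zero lifts to an automorphism of the Lie algebra
of the same order as `w`. -/
theorem mainTheorem6 {K L : Type*} [Field K] [IsAlgClosed K] [CharZero K]
    [LieRing L] [LieAlgebra K L] [FiniteDimensional K L] [LieAlgebra.IsSimple K L]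
    (H : LieSubalgebra K L) [H.IsCartanSubalgebra]
    (hsl : (LieAlgebra.IsKilling.rootSystem H).IsSimplyLaced)
    (w : LieAlgebra.rootLattice H ≃ₗ[ℤ] LieAlgebra.rootLattice H)
    (hw : w ∈ RootPairing.rootLatticeAut hsl) (hell : IsEllipticAut w) :
    ∃ σ : L ≃ₗ⁅K⁆ L, LieAlgebra.IsLiftOf H σ w ∧
      orderOf (σ.toLinearEquiv : L ≃ₗ[K] L) = orderOf w := by
  obtain ⟨G, hform, ht⟩ := LieAlgebra.IsKilling.exists_simplyLacedGrading hsl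
  have := RootPairing.free_rootSpan (LieAlgebra.IsKilling.rootSystem H)
  obtain ⟨σ, hσ, hord⟩ := G.exists_lieEquiv_orderOf_eq w (by rw [hform]; exact hw) hell
  refine ⟨σ, LieAlgebra.IsKilling.isLiftOf_of_apply_corootHom hsl hw fun x ↦ ?_, hord⟩
  rw [← ht, ← ht, hσ]
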